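/- For $s_1,\dots,s_r\in\mathbb{N}$ with $s_1>1$ let $$\zeta^\star(s_1,\dots,s_r)=\sum_{k_1\ge\cdots\ge k_r\ge 1}\frac{1}{k_1^{s_1}\cdots k_r^{s_r}}$$ be the (convergent) multiple zeta star value, let $\{a_1,\dots,a_k\}^d$ denote $d$ successive repetitions of the sequence $a_1,\dots,a_k$, and let $B_n$ be the Bernoulli numbers. Then for all positive integers $m$ and $d$, $$\zeta^\star\bigl(\{\{2\}^{m-1},3,\{2\}^{m-1},1\}^d\bigr)=\pi^{4md}\sum_{\substack{k_1,\dots,k_d\ge 0\\ k_1+3k_2+\cdots+(2d-1)k_d=2d}}\ \prod_{j=1}^{d}\frac{1}{k_j!}\left(\frac{(2-2^{2m(2j-1)})\,B_{2m(2j-1)}}{(2j-1)\,(2m(2j-1))!}\right)^{k_j}$$ and $$\zeta^\star\bigl(\{\{2\}^{m-1},3,\{2\}^{m-1},1\}^d,\{2\}^m\bigr)=(-1)^m\,\pi^{2m(2d+1)}\sum_{\substack{k_1,\dots,k_{d+1}\ge 0\\ k_1+3k_2+\cdots+(2d+1)k_{d+1}=2d+1}}\ \prod_{j=1}^{d+1}\frac{1}{k_j!}\left(\frac{(2-2^{2m(2j-1)})\,B_{2m(2j-1)}}{(2j-1)\,(2m(2j-1))!}\right)^{k_j}.$$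 Here the sums run over non-negative integers $k_j$ satisfying the displayed linear condition. -/

import Mathlib

/-- The index set of a multiple zeta star series of depth `r`:
the tuples `k₁ ≥ k₂ ≥ ⋯ ≥ k_r ≥ 1` of natural numbers. -/
abbrev StarTuple (r : ℕ) : Type :=
  {k : Fin r → ℕ // Antitone k ∧ ∀ i, 1 ≤ k i}

/-- The summand `1 / (k₁ ^ s₁ ⋯ k_r ^ s_r)` of the multiple zeta star series of `s`. -/
noncomputable def zetaStarTerm (s : List ℕ) (k : StarTuple s.length) : ℝ :=
  ∏ i : Fin s.length, 1 / (k.1 i : ℝ) ^ s.get i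

/-- The multiple zeta star value `ζ⋆(s₁, …, s_r)`. -/
noncomputable def zetaStar (s : List ℕ) : ℝ :=
  ∑' k : StarTuple s.length, zetaStarTerm s k

/-- The multi-index `{2}^{m-1}, 3, {2}^{m-1}, 1` (used for `m ≥ 1`). -/
def block (m : ℕ) : List ℕ :=
  List.replicate (m - 1) 2 ++ [3] ++ List.replicate (m - 1) 2 ++ [1]

/-- The multi-index `{{2}^{m-1}, 3, {2}^{m-1}, 1}^d`. -/
def blocks (m d : ℕ) : List ℕ :=
  (List.replicate d (block m)).flatten

/-- The tuples `(k₁, …, k_r)` of natural numbers with `k₁ + 3 k₂ + ⋯ + (2r-1) k_r = n`; the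
coordinate `j : Fin r` is `k_{j+1}`. The bound `k_j ≤ n` is automatic, see `mem_oddTuples`. -/
def oddTuples (r n : ℕ) : Finset (Fin r → ℕ) :=
  (Fintype.piFinset fun _ : Fin r => Finset.range (n + 1)).filter
    fun k => ∑ j : Fin r, (2 * (j : ℕ) + 1) * k j = n

theorem mem_oddTuples {r n : ℕ} {k : Fin r → ℕ} :
    k ∈ oddTuples r n ↔ ∑ j : Fin r, (2 * (j : ℕ) + 1) * k j = n := by
  simp only [oddTuples, Finset.mem_filter, Fintype.mem_piFinset, Finset.mem_range,
    and_iff_right_iff_imp]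
  intro h j
  have h1 := Finset.single_le_sum (f := fun j : Fin r => (2 * (j : ℕ) + 1) * k j)
    (fun _ _ => Nat.zero_le _) (Finset.mem_univ j)
  simp only [h] at h1
  nlinarith [Nat.zero_le ((j : ℕ) * k j)]

/-- The rational number `(2 - 2 ^ {2mq}) B_{2mq} / (q · (2mq)!)`. -/
noncomputable def bernoulliFactor (m q : ℕ) : ℚ :=
  (2 - 2 ^ (2 * m * q)) * bernoulli (2 * m * q) / ((q : ℚ) * (Nat.factorial (2 * m * q) : ℚ))

/-- The sum over `k₁ + 3 k₂ + ⋯ + (2r-1) k_r = n` of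
`∏_{j=1}^r (1 / k_j!) ((2 - 2 ^ {2m(2j-1)}) B_{2m(2j-1)} / ((2j-1) (2m(2j-1))!)) ^ {k_j}`. -/
noncomputable def bellSum (m r n : ℕ) : ℚ :=
  ∑ k ∈ oddTuples r n, ∏ j : Fin r,
    1 / (Nat.factorial (k j) : ℚ) * bernoulliFactor m (2 * (j : ℕ) + 1) ^ k j

/-!
Truncated star sums expand along the kernel `A n k = n!² / ((n - k)! (n + k)!)`: by the recurrences
of `A` in `n` and in `k`, if the star sums of `l` truncated at `n` are `2 * ∑ k, A n k * f k`, then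
so are those of `s :: l` for `s = 1, 2, 3`, with `f` changed by division by powers of `k` and by
summation, alternating or not. Starting from the empty multi-index with `f k = (-1)^(k - 1)`, a
whole block `{2}^{m-1}, 3, {2}^{m-1}, 1` applies `f ↦ v * pairedSum (v * pairedSum f)` for
`v k = (-1)^(k - 1) / k^(2 m)`.

Since `A n k → 1` as `n → ∞`, the star value is `2 * ∑ k, f k`. The iterated sums that arise are the
coefficients of `∏ k, (1 + v k X) / (1 - v k X)`, which is `exp (∑ j, 2 p_(2j+1) X^(2j+1) / (2j+1))`
with the odd power sums `p_i = ∑ k, (v k)^i`. These are alternating zeta values at even integers,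
hence rational multiples of powers of `π` given by Bernoulli numbers.
-/

open Finset Filter
open scoped Topology PowerSeries

section Kernel

/-- The kernel `n!² / ((n - k)! (n + k)!)`, written so that it vanishes for `k > n`. -/
def starKernel (K : Type*) [Field K] (n k : ℕ) : K :=
  n.choose k / (n + k).choose k

/-- The symmetric kernel sum `∑_{1 ≤ |j| ≤ n} n!² / ((n - j)! (n + j)!) f_|j|`. Sequences are
indexed from `0`, so that `f k` stands for the entry `j = k + 1`. -/
def kernelSum {K : Type*} [Field K] (f : ℕ → K) (n : ℕ) : K :=
  2 * ∑ k ∈ range n, starKernel K n (k + 1) * f k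

theorem starKernel_eq_zero {K : Type*} [Field K] {n k : ℕ} (h : n < k) : starKernel K n k = 0 := by
  simp [starKernel, Nat.choose_eq_zero_of_lt h]

theorem starKernel_nonneg {K : Type*} [Field K] [LinearOrder K] [IsStrictOrderedRing K]
    (n k : ℕ) : 0 ≤ starKernel K n k := by
  unfold starKernel
  positivity

theorem starKernel_le_one {K : Type*} [Field K] [LinearOrder K] [IsStrictOrderedRing K]
    (n k : ℕ) : starKernel K n k ≤ 1 :=
  div_le_one_of_le₀ (mod_cast Nat.choose_le_choose k (Nat.le_add_right n k)) (Nat.cast_nonneg _)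

theorem choose_succ_right_mul_succ {R : Type*} [CommRing R] (n k : ℕ) :
    (n.choose (k + 1) : R) * (k + 1) = n.choose k * (n - k) := by
  have h := congrArg (Nat.cast : ℕ → R) (Nat.choose_succ_right_eq n k)
  rcases le_or_gt k n with hk | hk
  · simpa [Nat.cast_sub hk] using h
  · simp [Nat.choose_eq_zero_of_lt hk, Nat.choose_eq_zero_of_lt (Nat.lt_succ_of_lt hk)]

variable {K : Type*} [Field K] [CharZero K]

theorem starKernel_succ_right (n k : ℕ) :
    ((n : K) + k + 1) * starKernel K n (k + 1) = (n - k) * starKernel K n k := by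
  have hk : (k : K) + 1 ≠ 0 := Nat.cast_add_one_ne_zero k
  have h₀ : ((n + k).choose k : K) ≠ 0 :=
    mod_cast (Nat.choose_pos (Nat.le_add_left k n)).ne'
  have h₁ : ((n + (k + 1)).choose (k + 1) : K) ≠ 0 :=
    mod_cast (Nat.choose_pos (Nat.le_add_left (k + 1) n)).ne'
  have hnum := choose_succ_right_mul_succ (R := K) n k
  have hden : ((n : K) + k + 1) * (n + k).choose k = (n + (k + 1)).choose (k + 1) * (k + 1) :=
    mod_cast Nat.add_one_mul_choose_eq (n + k) k
  rw [starKernel, starKernel, mul_div_assoc', mul_div_assoc', div_eq_div_iff h₁ h₀]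
  apply mul_right_cancel₀ hk
  linear_combination (n + k + 1 : K) * (n + k).choose k * hnum
    + (n - k : K) * n.choose k * hden

theorem starKernel_succ_left (n k : ℕ) :
    (((n : K) + 1) ^ 2 - k ^ 2) * starKernel K (n + 1) k =
      ((n : K) + 1) ^ 2 * starKernel K n k := by
  induction k with
  | zero => simp [starKernel]
  | succ k ih =>
    have h₁ := starKernel_succ_right (K := K) (n + 1) k
    have h₀ := starKernel_succ_right (K := K) n k
    have h : (n : K) + k + 1 ≠ 0 := mod_cast (n + k).succ_ne_zero
    push_cast at h₁ ⊢
    apply mul_left_cancel₀ h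
    linear_combination ((n : K) + k + 1) * (n - k) * h₁ - ((n : K) + 1) ^ 2 * h₀ + (n - k : K) * ih

theorem sum_starKernel (n : ℕ) :
    2 * ∑ k ∈ range n, ((k : K) + 1) * starKernel K n (k + 1) = n := by
  have telescope (k : ℕ) : 2 * (((k : K) + 1) * starKernel K n (k + 1)) =
      (n - k) * starKernel K n k - (n - (k + 1 : ℕ)) * starKernel K n (k + 1) := by
    push_cast
    linear_combination starKernel_succ_right (K := K) n k
  rw [mul_sum, sum_congr rfl fun k _ => telescope k, sum_range_sub']
  simp [starKernel]

theorem kernelSum_succ_sub (f : ℕ → K) (n : ℕ) :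
    ((n : K) + 1) ^ 2 * (kernelSum f (n + 1) - kernelSum f n) =
      kernelSum (fun k => ((k : K) + 1) ^ 2 * f k) (n + 1) := by
  have h : kernelSum f n = 2 * ∑ k ∈ range (n + 1), starKernel K n (k + 1) * f k := by
    rw [sum_range_succ, starKernel_eq_zero n.lt_succ_self, zero_mul, add_zero, kernelSum]
  rw [h, kernelSum, kernelSum, ← mul_sub, ← sum_sub_distrib, mul_left_comm, mul_sum]
  congr 1
  refine sum_congr rfl fun k _ => ?_
  have := starKernel_succ_left (K := K) n (k + 1)
  push_cast at this
  linear_combination f k * this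

end Kernel

section PairedSum

/-- The sum of two consecutive partial sums of `u`, that is `u L + 2 * ∑ k ∈ range L, u k`. -/
def pairedSum {R : Type*} [Semiring R] (u : ℕ → R) (L : ℕ) : R :=
  ∑ k ∈ range L, u k + ∑ k ∈ range (L + 1), u k

theorem sum_alternating_mul_pairedSum {R : Type*} [CommRing R] (u : ℕ → R) (L : ℕ) :
    ∑ k ∈ range L, (-1) ^ k * pairedSum u k = -(-1) ^ L * ∑ k ∈ range L, u k := by
  induction L with
  | zero => simp
  | succ L ih =>
    rw [sum_range_succ, ih, pairedSum]
    ring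

theorem pairedSum_alternating_mul_pairedSum {R : Type*} [CommRing R] (u : ℕ → R) (L : ℕ) :
    pairedSum (fun k => (-1) ^ k * pairedSum u k) L = (-1) ^ L * u L := by
  rw [pairedSum, sum_alternating_mul_pairedSum, sum_alternating_mul_pairedSum, sum_range_succ]
  ring

theorem pairedSum_alternating {R : Type*} [CommRing R] :
    pairedSum (fun k => (-1 : R) ^ k) = 1 := by
  funext L
  induction L with
  | zero => simp [pairedSum]
  | succ L ih =>
    simp only [pairedSum, sum_range_succ, Pi.one_apply] at ih ⊢
    linear_combination ih

theorem tendsto_pairedSum {R : Type*} [Semiring R] [TopologicalSpace R] [ContinuousAdd R]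
    {u : ℕ → R} {a : R} (hu : HasSum u a) : Tendsto (pairedSum u) atTop (𝓝 (a + a)) :=
  hu.tendsto_sum_nat.add (hu.tendsto_sum_nat.comp (tendsto_add_atTop_nat 1))

theorem natCast_mul_kernelSum {K : Type*} [Field K] [CharZero K] (f : ℕ → K) (n : ℕ) :
    (n : K) * kernelSum f n = kernelSum (fun k => ((k : K) + 1) * pairedSum f k) n := by
  -- Summation by parts: the difference of the two summands telescopes.
  have telescope (k : ℕ) : (n : K) * (starKernel K n (k + 1) * f k)
      - starKernel K n (k + 1) * ((k + 1) * pairedSum f k) =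
        (n - (k + 1 : ℕ)) * starKernel K n (k + 1) * ∑ i ∈ range (k + 1), f i
          - (n - k) * starKernel K n k * ∑ i ∈ range k, f i := by
    rw [pairedSum, sum_range_succ]
    push_cast
    linear_combination (-∑ i ∈ range k, f i) * starKernel_succ_right (K := K) n k
  have h := sum_congr rfl fun k (_ : k ∈ range n) => telescope k
  rw [sum_range_sub fun k => ((n : K) - k) * starKernel K n k * ∑ i ∈ range k, f i,
    sum_sub_distrib, ← mul_sum] at h
  simp only [sub_self, range_zero, sum_empty, zero_mul, mul_zero] at h
  rw [kernelSum, kernelSum]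
  linear_combination 2 * h

theorem kernelSum_alternating {K : Type*} [Field K] [CharZero K] (n : ℕ) :
    kernelSum (fun k => (-1 : K) ^ k) (n + 1) = 1 := by
  have hn : ((n + 1 : ℕ) : K) ≠ 0 := Nat.cast_ne_zero.2 n.succ_ne_zero
  apply mul_left_cancel₀ hn
  rw [natCast_mul_kernelSum, pairedSum_alternating, mul_one, kernelSum, ← sum_starKernel (n + 1)]
  simp only [Pi.one_apply, mul_one, mul_comm (starKernel _ _ _)]

end PairedSum

section KernelExpansion

/-- The truncation to `k₁ ≤ n` of the multiple zeta star series. -/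
def harmonicStar (K : Type*) [Field K] : List ℕ → ℕ → K
  | [], _ => 1
  | s :: l, n => ∑ j ∈ range n, 1 / ((j : K) + 1) ^ s * harmonicStar K l (j + 1)

/-- The truncated star sums of `l` are the kernel sums of `f`. The truncation at `0` is excluded
because there the empty multi-index has star sum `1`, whereas all kernel sums vanish. -/
def HasKernelExpansion {K : Type*} [Field K] (l : List ℕ) (f : ℕ → K) : Prop :=
  ∀ n, harmonicStar K l (n + 1) = kernelSum f (n + 1)

/-- The signed weights `(-1)^(j-1) / j^(2m)` at `j = k + 1`, whose sum is the alternating zeta value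
of weight `2m`. -/
def altWeight (K : Type*) [Field K] (m k : ℕ) : K :=
  (-1) ^ k / ((k : K) + 1) ^ (2 * m)

/-- The sequences obtained from the constant sequence `1` by iterating `u ↦ pairedSum (v * u)`.
They occur in the kernel expansions of `blocks m d` and of `blocks m d ++ List.replicate m 2`
for `v = altWeight K m`. -/
def starCoeff {R : Type*} [Semiring R] (v : ℕ → R) : ℕ → ℕ → R
  | 0 => 1
  | j + 1 => pairedSum (v * starCoeff v j)

namespace HasKernelExpansion

variable {K : Type*} [Field K] [CharZero K] {l : List ℕ} {f g : ℕ → K}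

theorem nil : HasKernelExpansion [] fun k => (-1 : K) ^ k :=
  fun n => (kernelSum_alternating n).symm

theorem cons {s : ℕ} (h : HasKernelExpansion l f) (hg : ∀ n : ℕ,
    kernelSum f (n + 1) = ((n : K) + 1) ^ s * (kernelSum g (n + 1) - kernelSum g n)) :
    HasKernelExpansion (s :: l) g := by
  have key (n : ℕ) : harmonicStar K (s :: l) n = kernelSum g n := by
    induction n with
    | zero => simp [harmonicStar, kernelSum]
    | succ n ih =>
      have hn : (n : K) + 1 ≠ 0 := Nat.cast_add_one_ne_zero n
      rw [harmonicStar] at ih ⊢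
      rw [sum_range_succ, ih, h n, hg n]
      field_simp
      ring
  exact fun n => key (n + 1)

theorem cons_two (h : HasKernelExpansion l f) :
    HasKernelExpansion (2 :: l) fun k => f k / ((k : K) + 1) ^ 2 := by
  refine h.cons fun n => ?_
  rw [kernelSum_succ_sub]
  congr! 2 with k
  have hk : (k : K) + 1 ≠ 0 := Nat.cast_add_one_ne_zero k
  field_simp

theorem cons_one (h : HasKernelExpansion l f) :
    HasKernelExpansion (1 :: l) fun k => pairedSum f k / ((k : K) + 1) := by
  refine h.cons fun n => ?_
  have hn : (n : K) + 1 ≠ 0 := Nat.cast_add_one_ne_zero n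
  apply mul_left_cancel₀ hn
  rw [pow_one, ← mul_assoc, ← sq, kernelSum_succ_sub, ← Nat.cast_succ, natCast_mul_kernelSum]
  congr! 2 with k
  have hk : (k : K) + 1 ≠ 0 := Nat.cast_add_one_ne_zero k
  field_simp

theorem cons_three (h : HasKernelExpansion l f) :
    HasKernelExpansion (3 :: l) fun k =>
      (-1) ^ k * pairedSum (fun j => (-1) ^ j * (f j / ((j : K) + 1))) k / ((k : K) + 1) ^ 2 := by
  set g : ℕ → K := fun k => (-1) ^ k * pairedSum (fun j => (-1) ^ j * (f j / ((j : K) + 1))) k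
  have hg (k : ℕ) : ((k : K) + 1) * pairedSum g k = f k := by
    have hk : (k : K) + 1 ≠ 0 := Nat.cast_add_one_ne_zero k
    rw [pairedSum_alternating_mul_pairedSum, ← mul_assoc ((-1) ^ k), ← mul_pow]
    field_simp
    simp
  refine h.cons fun n => ?_
  have hn := natCast_mul_kernelSum g (n + 1)
  have hsub := kernelSum_succ_sub (fun k => g k / ((k : K) + 1) ^ 2) n
  have hcancel (k : ℕ) : ((k : K) + 1) ^ 2 * (g k / ((k : K) + 1) ^ 2) = g k :=
    mul_div_cancel₀ _ (pow_ne_zero 2 (Nat.cast_add_one_ne_zero k))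
  simp only [hg, hcancel] at hn hsub
  rw [← hn, ← hsub]
  push_cast
  ring

theorem replicate_two_append (h : HasKernelExpansion l f) (i : ℕ) :
    HasKernelExpansion (List.replicate i 2 ++ l) fun k => f k / ((k : K) + 1) ^ (2 * i) := by
  induction i with
  | zero => simpa using h
  | succ i ih =>
    simpa only [List.replicate_succ, List.cons_append, div_div, ← pow_add, mul_add_one]
      using ih.cons_two

theorem block_append (h : HasKernelExpansion l f) {m : ℕ} (hm : 0 < m) :
    HasKernelExpansion (block m ++ l)
      (altWeight K m * pairedSum (altWeight K m * pairedSum f)) := by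
  obtain ⟨i, rfl⟩ := Nat.exists_eq_add_one.2 hm
  have hblock : block (i + 1) ++ l =
      List.replicate i 2 ++ 3 :: (List.replicate i 2 ++ 1 :: l) := by simp [block]
  have hweight (u : ℕ → K) : altWeight K (i + 1) * u =
      fun k => (-1) ^ k * u k / ((k : K) + 1) ^ 2 / ((k : K) + 1) ^ (2 * i) := by
    funext k
    rw [Pi.mul_apply, altWeight, div_div, ← pow_add, mul_add_one, add_comm 2, div_mul_eq_mul_div]
  have hinner : (fun j => (-1) ^ j * (pairedSum f j / ((j : K) + 1) / ((j : K) + 1) ^ (2 * i) /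
      ((j : K) + 1))) = altWeight K (i + 1) * pairedSum f := by
    rw [hweight]
    funext j
    field_simp
  have hexp := (h.cons_one.replicate_two_append i).cons_three.replicate_two_append i
  rwa [hinner, ← hweight, ← hblock] at hexp

theorem blocks_append {m n : ℕ} (hm : 0 < m)
    (h : HasKernelExpansion l (altWeight K m * starCoeff (altWeight K m) n)) (d : ℕ) :
    HasKernelExpansion (blocks m d ++ l)
      (altWeight K m * starCoeff (altWeight K m) (2 * d + n)) := by
  induction d with
  | zero => simpa [blocks] using h
  | succ d ih =>
    have hsucc : blocks m (d + 1) ++ l = block m ++ (blocks m d ++ l) := by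
      simp [blocks, List.replicate_succ]
    rw [hsucc, show 2 * (d + 1) + n = 2 * d + n + 2 by ring]
    exact ih.block_append hm

end HasKernelExpansion

variable {K : Type*} [Field K] [CharZero K]

theorem hasKernelExpansion_replicate_two (m : ℕ) :
    HasKernelExpansion (List.replicate m 2) (altWeight K m * starCoeff (altWeight K m) 0) := by
  rw [starCoeff, mul_one, ← List.append_nil (List.replicate m 2)]
  exact HasKernelExpansion.nil.replicate_two_append m

theorem hasKernelExpansion_block {m : ℕ} (hm : 0 < m) :
    HasKernelExpansion (block m) (altWeight K m * starCoeff (altWeight K m) 1) := by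
  simpa [pairedSum_alternating, starCoeff] using
    (HasKernelExpansion.nil (K := K)).block_append hm

theorem hasKernelExpansion_blocks {m : ℕ} (hm : 0 < m) (d : ℕ) :
    HasKernelExpansion (blocks m (d + 1))
      (altWeight K m * starCoeff (altWeight K m) (2 * d + 1)) := by
  have hsucc : blocks m (d + 1) = blocks m d ++ block m := by
    simp [blocks, List.replicate_succ']
  rw [hsucc]
  exact (hasKernelExpansion_block hm).blocks_append hm d

theorem hasKernelExpansion_blocks_append_replicate_two {m : ℕ} (hm : 0 < m) (d : ℕ) :
    HasKernelExpansion (blocks m d ++ List.replicate m 2)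
      (altWeight K m * starCoeff (altWeight K m) (2 * d)) :=
  (hasKernelExpansion_replicate_two m).blocks_append hm d

end KernelExpansion

section LogarithmicDerivative

theorem derivation_prod_eq_mul_sum {R A ι : Type*} [CommSemiring R] [CommSemiring A]
    [Algebra R A] (D : Derivation R A A) {F S : ι → A} (s : Finset ι)
    (h : ∀ i ∈ s, D (F i) = F i * S i) : D (∏ i ∈ s, F i) = (∏ i ∈ s, F i) * ∑ i ∈ s, S i := by
  classical
  induction s using Finset.induction_on with
  | empty => simp
  | insert i s hi ih =>
    rw [prod_insert hi, sum_insert hi, D.leibniz, h i (mem_insert_self i s),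
      ih fun j hj => h j (mem_insert_of_mem hj), smul_eq_mul, smul_eq_mul]
    ring

theorem coeff_eq_of_derivative_eq_mul {R : Type*} [CommRing R] [IsAddTorsionFree R]
    {F G S T : R⟦X⟧} {N : ℕ} (hF : d⁄dX R F = F * S) (hG : d⁄dX R G = G * T)
    (h0 : F.coeff 0 = G.coeff 0) (hST : ∀ i < N, S.coeff i = T.coeff i) :
    ∀ n ≤ N, F.coeff n = G.coeff n := by
  intro n
  induction n using Nat.strong_induction_on with
  | _ n ih =>
    intro hn
    rcases n with _ | n
    · exact h0
    have hcoeff : (d⁄dX R F).coeff n = (d⁄dX R G).coeff n := by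
      rw [hF, hG, PowerSeries.coeff_mul, PowerSeries.coeff_mul]
      refine sum_congr rfl fun p hp => ?_
      have hp := mem_antidiagonal.1 hp
      rw [ih p.1 (by lia) (by lia), hST p.2 (by lia)]
    rw [PowerSeries.coeff_derivative, PowerSeries.coeff_derivative, mul_comm, mul_comm (G.coeff _),
      ← Nat.cast_succ, ← nsmul_eq_mul, ← nsmul_eq_mul] at hcoeff
    exact nsmul_right_injective n.succ_ne_zero hcoeff

end LogarithmicDerivative

section CayleySeries

open PowerSeries

/-- The geometric series `1 / (1 - c X)`. -/
def geomSeries {R : Type*} [Semiring R] (c : R) : R⟦X⟧ :=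
  mk fun n => c ^ n

/-- The series `(1 + c X) / (1 - c X)`; products of such series generate the kernel expansions of
the multiple zeta star values. -/
noncomputable def cayleySeries {R : Type*} [CommRing R] (c : R) : R⟦X⟧ :=
  (1 + C c * X) * geomSeries c

variable {R : Type*} [CommRing R]

theorem geomSeries_mul_one_sub (c : R) : geomSeries c * (1 - C c * X) = 1 := by
  simpa [geomSeries, rescale_mk, rescale_X] using
    congrArg (rescale c) (mk_one_mul_one_sub_eq_one R)

theorem cayleySeries_mul_one_sub (c : R) : cayleySeries c * (1 - C c * X) = 1 + C c * X := by
  rw [cayleySeries, mul_assoc, geomSeries_mul_one_sub, mul_one]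

theorem derivative_geomSeries (c : R) : d⁄dX R (geomSeries c) = C c * geomSeries c ^ 2 := by
  have hgeom := geomSeries_mul_one_sub c
  have h := congrArg (d⁄dX R) hgeom
  simp only [Derivation.leibniz, map_sub, derivative_C, derivative_X, derivative_one,
    smul_eq_mul] at h
  linear_combination geomSeries c * h - d⁄dX R (geomSeries c) * hgeom

theorem derivative_cayleySeries (c : R) :
    d⁄dX R (cayleySeries c) = cayleySeries c * (C c * (geomSeries c + geomSeries (-c))) := by
  have hpos := geomSeries_mul_one_sub c
  have hneg := geomSeries_mul_one_sub (-c)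
  simp only [map_neg, neg_mul, sub_neg_eq_add] at hneg
  have hsum : (1 + C c * X) * (geomSeries c + geomSeries (-c)) = 2 * geomSeries c := by
    linear_combination hneg - hpos
  simp only [cayleySeries, Derivation.leibniz, map_add, derivative_C, derivative_X, derivative_one,
    derivative_geomSeries, smul_eq_mul]
  linear_combination -(C c * geomSeries c) * hsum - (C c * geomSeries c) * hpos

theorem coeff_two_mul_geomSeries_add (c : R) (j : ℕ) :
    (C c * (geomSeries c + geomSeries (-c))).coeff (2 * j) = 2 * c ^ (2 * j + 1) := by
  simp only [geomSeries, coeff_C_mul, map_add, coeff_mk, (even_two_mul j).neg_pow]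
  ring

theorem coeff_two_mul_add_one_geomSeries_add (c : R) (j : ℕ) :
    (C c * (geomSeries c + geomSeries (-c))).coeff (2 * j + 1) = 0 := by
  simp only [geomSeries, coeff_C_mul, map_add, coeff_mk, (odd_two_mul_add_one j).neg_pow,
    add_neg_cancel, mul_zero]

theorem coeff_zero_prod_cayleySeries {ι : Type*} (v : ι → R) (s : Finset ι) :
    (∏ i ∈ s, cayleySeries (v i)).coeff 0 = 1 := by
  rw [coeff_zero_eq_constantCoeff_apply, map_prod]
  exact prod_eq_one fun i _ => by simp [cayleySeries, geomSeries]

theorem coeff_succ_prod_cayleySeries_succ (v : ℕ → R) (n L : ℕ) :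
    (∏ k ∈ range (L + 1), cayleySeries (v k)).coeff (n + 1) =
      (∏ k ∈ range L, cayleySeries (v k)).coeff (n + 1) +
        v L * ((∏ k ∈ range L, cayleySeries (v k)).coeff n +
          (∏ k ∈ range (L + 1), cayleySeries (v k)).coeff n) := by
  have h : ∏ k ∈ range (L + 1), cayleySeries (v k) = ∏ k ∈ range L, cayleySeries (v k) +
      C (v L) * (∏ k ∈ range L, cayleySeries (v k) + ∏ k ∈ range (L + 1), cayleySeries (v k))
        * X := by
    rw [prod_range_succ]
    linear_combination (∏ k ∈ range L, cayleySeries (v k)) * cayleySeries_mul_one_sub (v L)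
  have hcoeff := congrArg (coeff (n + 1)) h
  rwa [map_add, coeff_succ_mul_X, coeff_C_mul, map_add] at hcoeff

theorem coeff_succ_prod_cayleySeries (v : ℕ → R) (n L : ℕ) :
    (∏ k ∈ range L, cayleySeries (v k)).coeff (n + 1) =
      2 * ∑ k ∈ range L, v k * starCoeff v n k := by
  induction n generalizing L with
  | zero =>
    induction L with
    | zero => simp [coeff_one]
    | succ L ih =>
      rw [coeff_succ_prod_cayleySeries_succ, ih, coeff_zero_prod_cayleySeries,
        coeff_zero_prod_cayleySeries, sum_range_succ, starCoeff, Pi.one_apply]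
      ring
  | succ n ihn =>
    induction L with
    | zero => simp [coeff_one]
    | succ L ih =>
      rw [coeff_succ_prod_cayleySeries_succ, ih, ihn, ihn,
        sum_range_succ fun k => v k * starCoeff v (n + 1) k]
      simp only [starCoeff, pairedSum, Pi.mul_apply]
      ring

end CayleySeries

section OddBell

open PowerSeries

variable {K : Type*} [Field K]

/-- The sum of `∏ j, t j ^ k j / (k j)!` over `oddTuples r n`: the coefficient of `X ^ n` in
`exp (∑ j < r, t j * X ^ (2 * j + 1))`. -/
def oddBell (r : ℕ) (t : ℕ → K) (n : ℕ) : K :=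
  ∑ k ∈ oddTuples r n, ∏ j : Fin r, 1 / ((k j).factorial : K) * t j ^ k j

theorem oddBell_pow_mul (r n : ℕ) (c : K) (b : ℕ → K) :
    oddBell r (fun j => c ^ (2 * j + 1) * b j) n = c ^ n * oddBell r b n := by
  rw [oddBell, oddBell, mul_sum]
  refine sum_congr rfl fun k hk => ?_
  rw [← mem_oddTuples.1 hk, ← prod_pow_eq_pow_sum, ← prod_mul_distrib]
  refine prod_congr rfl fun j _ => ?_
  rw [mul_pow, ← pow_mul, mul_left_comm]

theorem derivative_rescale {R : Type*} [CommSemiring R] (t : R) (f : R⟦X⟧) :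
    d⁄dX R (rescale t f) = t • rescale t (d⁄dX R f) := by
  ext n
  simp only [coeff_derivative, coeff_rescale, map_smul, smul_eq_mul]
  ring

variable [CharZero K]

/-- The series `exp (t X ^ w)`. -/
noncomputable def expMonomial (t : K) (w : ℕ) (hw : w ≠ 0) : K⟦X⟧ :=
  (rescale t (exp K)).expand w hw

theorem derivative_expMonomial (t : K) {w : ℕ} (hw : w ≠ 0) :
    d⁄dX K (expMonomial t w hw) =
      expMonomial t w hw * monomial (w - 1) (w * t) := by
  rw [expMonomial, expand_apply,
    derivative_subst (HasSubst.X_pow hw), derivative_rescale,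
    derivative_exp, ← expand_apply w hw,
    ← expand_apply w hw, expand_smul,
    derivative_pow, derivative_X, mul_one,
    monomial_eq_C_mul_X_pow, smul_eq_C_mul, map_mul, map_natCast]
  ring

theorem coeff_mul_expMonomial (t : K) {w : ℕ} (hw : w ≠ 0) (k : ℕ) :
    (expMonomial t w hw).coeff (w * k) = 1 / (k.factorial : K) * t ^ k := by
  rw [expMonomial, coeff_expand_mul, coeff_rescale, coeff_exp]
  simp [mul_comm]

theorem constantCoeff_expMonomial (t : K) {w : ℕ} (hw : w ≠ 0) :
    constantCoeff (expMonomial t w hw) = 1 := by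
  simpa using coeff_mul_expMonomial t hw 0

theorem coeff_prod_expMonomial (r : ℕ) (t : ℕ → K) (n : ℕ) :
    (∏ j : Fin r, expMonomial (t j) (2 * j + 1) (2 * (j : ℕ)).succ_ne_zero).coeff n =
      oddBell r t n := by
  rw [coeff_prod, oddBell]
  symm
  refine sum_of_injOn
    (fun k => Finsupp.equivFunOnFinite.symm fun j => (2 * (j : ℕ) + 1) * k j) ?_ ?_ ?_ ?_
  · intro k _ k' _ h
    funext j
    have hj := DFunLike.congr_fun h j
    exact Nat.eq_of_mul_eq_mul_left (2 * (j : ℕ)).succ_pos hj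
  · intro k hk
    simpa [mem_finsuppAntidiag] using mem_oddTuples.1 hk
  · intro l hl hl'
    have : ∃ j : Fin r, ¬ 2 * (j : ℕ) + 1 ∣ l j := by
      by_contra! hdvd
      choose k hk using hdvd
      refine hl' ⟨k, mem_oddTuples.2 ?_, Finsupp.ext fun j => (hk j).symm⟩
      simpa [← hk] using hl
    obtain ⟨j, hj⟩ := this
    exact prod_eq_zero (mem_univ j) (coeff_expand_of_not_dvd _ _ _ hj)
  · intro k _
    exact prod_congr rfl fun j _ => (coeff_mul_expMonomial _ _ _).symm

theorem coeff_prod_cayleySeries_eq_oddBell (v : ℕ → K) (L : ℕ) {r n : ℕ} (hn : n ≤ 2 * r) :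
    (∏ k ∈ range L, cayleySeries (v k)).coeff n =
      oddBell r (fun j => 2 / (2 * j + 1) * ∑ k ∈ range L, v k ^ (2 * j + 1)) n := by
  have hF := derivation_prod_eq_mul_sum (d⁄dX K) (range L) fun k _ => derivative_cayleySeries (v k)
  rw [← coeff_prod_expMonomial]
  refine coeff_eq_of_derivative_eq_mul (N := 2 * r) hF
    (derivation_prod_eq_mul_sum (d⁄dX K) univ fun j _ => derivative_expMonomial _ _) ?_ ?_ n hn
  · rw [coeff_zero_prod_cayleySeries, coeff_zero_eq_constantCoeff_apply, map_prod]
    exact (prod_eq_one fun j _ => constantCoeff_expMonomial _ _).symm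
  · intro i hi
    simp only [map_sum, coeff_monomial, Nat.add_sub_cancel]
    obtain ⟨j, rfl | rfl⟩ := i.even_or_odd'
    · have hj : ((2 * j + 1 : ℕ) : K) ≠ 0 := Nat.cast_ne_zero.2 (2 * j).succ_ne_zero
      rw [Fintype.sum_eq_single ⟨j, by lia⟩ fun j' hj' => if_neg fun h => hj' (Fin.ext (by lia)),
        if_pos rfl, sum_congr rfl fun k _ => coeff_two_mul_geomSeries_add (v k) j, ← mul_sum]
      push_cast at hj ⊢
      rw [← mul_assoc, mul_div_cancel₀ _ hj]
    · rw [sum_eq_zero fun k _ => coeff_two_mul_add_one_geomSeries_add (v k) j,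
        sum_eq_zero fun j' _ => if_neg (by lia)]

end OddBell

section Limits

theorem tendsto_starKernel (k : ℕ) : Tendsto (fun n => starKernel ℝ n k) atTop (𝓝 1) := by
  induction k with
  | zero => simp [starKernel]
  | succ k ih =>
    have hratio : Tendsto (fun n : ℕ => ((n : ℝ) - k) / (n + (k + 1))) atTop (𝓝 1) := by
      have hinv : Tendsto (fun n : ℕ => (2 * (k : ℝ) + 1) / (n + (k + 1))) atTop (𝓝 0) :=
        tendsto_const_nhds.div_atTop
          (tendsto_atTop_add_const_right _ _ tendsto_natCast_atTop_atTop)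
      refine (by simpa using hinv.const_sub 1 : Tendsto _ _ _).congr fun n => ?_
      have hn : (n : ℝ) + (k + 1) ≠ 0 := by positivity
      field_simp
      ring
    refine (by simpa using hratio.mul ih : Tendsto _ _ _).congr fun n => ?_
    have hn : (n : ℝ) + (k + 1) ≠ 0 := by positivity
    rw [div_mul_eq_mul_div, ← starKernel_succ_right, add_assoc, mul_div_cancel_left₀ _ hn]

theorem tendsto_kernelSum {f : ℕ → ℝ} (hf : Summable f) :
    Tendsto (kernelSum f) atTop (𝓝 (2 * ∑' k, f k)) := by
  have htsum (n : ℕ) : kernelSum f n = 2 * ∑' k, starKernel ℝ n (k + 1) * f k := by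
    rw [kernelSum, tsum_eq_sum fun k hk => ?_]
    rw [starKernel_eq_zero (Nat.lt_succ_of_le (not_lt.1 (mt mem_range.2 hk))), zero_mul]
  simp only [funext htsum]
  refine (tendsto_tsum_of_dominated_convergence hf.abs (fun k => ?_)
    (Eventually.of_forall fun n k => ?_)).const_mul 2
  · simpa using (tendsto_starKernel (k + 1)).mul_const (f k)
  · rw [norm_mul, Real.norm_of_nonneg (starKernel_nonneg _ _), Real.norm_eq_abs]
    exact mul_le_of_le_one_left (abs_nonneg _) (starKernel_le_one _ _)

theorem summable_mul_starCoeff {v : ℕ → ℝ} (hv : Summable v) (n : ℕ) :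
    Summable (v * starCoeff v n) := by
  induction n with
  | zero => simpa [starCoeff] using hv
  | succ n ih =>
    have hlim := tendsto_pairedSum ih.hasSum
    rw [← Nat.cofinite_eq_atTop] at hlim
    exact hv.norm.mul_tendsto_const hlim

theorem tendsto_oddBell {K : Type*} [Field K] [TopologicalSpace K] [IsTopologicalSemiring K]
    {ι : Type*} {F : Filter ι} {r n : ℕ} {t : ι → ℕ → K} {s : ℕ → K}
    (h : ∀ j < r, Tendsto (fun i => t i j) F (𝓝 (s j))) :
    Tendsto (fun i => oddBell r (t i) n) F (𝓝 (oddBell r s n)) :=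
  tendsto_finsetSum _ fun _ _ => tendsto_finsetProd _ fun j _ =>
    ((h j j.2).pow _).const_mul _

theorem two_mul_tsum_mul_starCoeff {v : ℕ → ℝ} (hv : Summable v) {r n : ℕ} (hn : n + 1 ≤ 2 * r)
    {s : ℕ → ℝ} (hs : ∀ j < r, HasSum (fun k => 2 / (2 * (j : ℝ) + 1) * v k ^ (2 * j + 1)) (s j)) :
    2 * ∑' k, v k * starCoeff v n k = oddBell r s (n + 1) := by
  have hpartial := (summable_mul_starCoeff hv n).hasSum.tendsto_sum_nat.const_mul 2
  have hbell := tendsto_oddBell (n := n + 1) fun j hj => (hs j hj).tendsto_sum_nat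
  refine tendsto_nhds_unique hpartial (hbell.congr fun L => ?_)
  simp only [← mul_sum, Pi.mul_apply]
  rw [← coeff_prod_cayleySeries_eq_oddBell v L hn, coeff_succ_prod_cayleySeries]

end Limits

section BoundedTuples

/-- The index tuples `n ≥ k₁ ≥ ⋯ ≥ k_r ≥ 1` of a truncated multiple zeta star series. -/
def boundedTuples (r n : ℕ) : Finset (Fin r → ℕ) :=
  {k ∈ Fintype.piFinset fun _ : Fin r => Icc 1 n | Antitone k}

theorem mem_boundedTuples {r n : ℕ} {k : Fin r → ℕ} :
    k ∈ boundedTuples r n ↔ (∀ i, 1 ≤ k i ∧ k i ≤ n) ∧ Antitone k := by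
  simp [boundedTuples]

theorem cons_mem_boundedTuples {r n j : ℕ} {k : Fin r → ℕ} :
    (Fin.cons j k : Fin (r + 1) → ℕ) ∈ boundedTuples (r + 1) n ↔
      (1 ≤ j ∧ j ≤ n) ∧ k ∈ boundedTuples r j := by
  simp only [mem_boundedTuples, Antitone, Fin.forall_fin_succ, Fin.cons_zero, Fin.cons_succ,
    Fin.succ_le_succ_iff, Fin.zero_le, Fin.le_zero_iff, Fin.succ_ne_zero, le_refl, forall_true_left,
    false_imp_iff, implies_true, true_and]
  constructor
  · rintro ⟨⟨hj, hk⟩, hjk, hanti⟩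
    exact ⟨hj, fun i => ⟨(hk i).1, hjk i⟩, hanti⟩
  · rintro ⟨hj, hk, hanti⟩
    exact ⟨⟨hj, fun i => ⟨(hk i).1, (hk i).2.trans hj.2⟩⟩, fun i => (hk i).2, hanti⟩

theorem sum_boundedTuples_succ {M : Type*} [AddCommMonoid M] {r : ℕ} (n : ℕ)
    (F : (Fin (r + 1) → ℕ) → M) :
    ∑ k ∈ boundedTuples (r + 1) n, F k =
      ∑ j ∈ range n, ∑ k ∈ boundedTuples r (j + 1), F (Fin.cons (j + 1) k) := by
  have hhead {k : Fin (r + 1) → ℕ} (hk : k ∈ boundedTuples (r + 1) n) : k 0 - 1 + 1 = k 0 :=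
    Nat.sub_add_cancel ((mem_boundedTuples.1 hk).1 0).1
  rw [sum_sigma']
  refine sum_bij' (fun k _ => ⟨k 0 - 1, Fin.tail k⟩) (fun p _ => Fin.cons (p.1 + 1) p.2)
    (fun k hk => ?_) (fun p hp => ?_) (fun k hk => ?_) (fun p _ => ?_) fun k hk => ?_
  · have hcons := hk
    rw [← Fin.cons_self_tail k, cons_mem_boundedTuples] at hcons
    rw [mem_sigma, mem_range, hhead hk]
    exact ⟨by lia, hcons.2⟩
  · rw [mem_sigma, mem_range] at hp
    exact cons_mem_boundedTuples.2 ⟨by lia, hp.2⟩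
  · rw [hhead hk, Fin.cons_self_tail]
  · simp
  · rw [hhead hk, Fin.cons_self_tail]

theorem sum_boundedTuples_eq_harmonicStar {K : Type*} [Field K] (s : List ℕ) (n : ℕ) :
    ∑ k ∈ boundedTuples s.length n, ∏ i : Fin s.length, 1 / (k i : K) ^ s.get i =
      harmonicStar K s n := by
  induction s generalizing n with
  | nil => simp [boundedTuples, harmonicStar, Subsingleton.antitone]
  | cons a l ih =>
    refine (sum_boundedTuples_succ (r := l.length) n _).trans (sum_congr rfl fun j _ => ?_)
    rw [← ih, mul_sum]
    refine sum_congr rfl fun k _ => (Fin.prod_univ_succ (n := l.length) _).trans ?_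
    simp

theorem hasSum_of_tendsto_sum_monotone {ι : Type*} {f : ι → ℝ} (hf : 0 ≤ f)
    {T : ℕ → Finset ι} (hT : Monotone T) (hcover : ∀ i, ∃ n, i ∈ T n) {a : ℝ}
    (h : Tendsto (fun n => ∑ i ∈ T n, f i) atTop (𝓝 a)) : HasSum f a :=
  (tendsto_iff_tendsto_subseq_of_monotone (sum_mono_set_of_nonneg hf)
    (tendsto_atTop_finset_of_monotone hT hcover)).2 h

theorem hasSum_zetaStarTerm {s : List ℕ} {a : ℝ} (h : Tendsto (harmonicStar ℝ s) atTop (𝓝 a)) :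
    HasSum (zetaStarTerm s) a := by
  classical
  refine hasSum_of_tendsto_sum_monotone (fun k => prod_nonneg fun _ _ => by positivity)
    (T := fun n => (boundedTuples s.length n).subtype _) (fun n n' hn k hk => ?_)
    (fun k => ⟨∑ i, k.1 i, ?_⟩) (h.congr fun n => ?_)
  · rw [mem_subtype, mem_boundedTuples] at hk ⊢
    exact ⟨fun i => ⟨(hk.1 i).1, (hk.1 i).2.trans hn⟩, hk.2⟩
  · rw [mem_subtype, mem_boundedTuples]
    exact ⟨fun i => ⟨k.2.2 i, single_le_sum (fun _ _ => Nat.zero_le _) (mem_univ i)⟩, k.2.1⟩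
  · rw [← sum_boundedTuples_eq_harmonicStar]
    refine (sum_subtype_of_mem (fun k : Fin s.length → ℕ => ∏ i, 1 / (k i : ℝ) ^ s.get i)
      fun k hk => ?_).symm
    obtain ⟨hbound, hanti⟩ := mem_boundedTuples.1 hk
    exact ⟨hanti, fun i => (hbound i).1⟩

theorem HasKernelExpansion.hasSum {s : List ℕ} {f : ℕ → ℝ} (h : HasKernelExpansion s f)
    (hf : Summable f) : HasSum (zetaStarTerm s) (2 * ∑' k, f k) :=
  hasSum_zetaStarTerm <| (tendsto_add_atTop_iff_nat 1).1 <|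
    ((tendsto_kernelSum hf).comp (tendsto_add_atTop_nat 1)).congr fun n => (h n).symm

end BoundedTuples

section BernoulliValues

theorem hasSum_alternating_zeta {N : ℕ} (hN : N ≠ 0) :
    HasSum (fun k : ℕ => (-1) ^ k / ((k : ℝ) + 1) ^ (2 * N))
      ((-1) ^ N * Real.pi ^ (2 * N) * ((2 - 2 ^ (2 * N)) * bernoulli (2 * N) /
        (2 * (2 * N).factorial))) := by
  have hcos := hasSum_one_div_nat_pow_mul_cos hN (x := 2⁻¹) (by norm_num)
  change HasSum _ (_ * bernoulliFun (2 * N) 2⁻¹) at hcos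
  rw [bernoulliFun_eval_half] at hcos
  have hterm (k : ℕ) : (-1) ^ k / ((k : ℝ) + 1) ^ (2 * N) =
      -(1 / ((k + 1 : ℕ) : ℝ) ^ (2 * N) * Real.cos (2 * Real.pi * (k + 1 : ℕ) * 2⁻¹)) := by
    have harg : 2 * Real.pi * (k + 1 : ℕ) * 2⁻¹ = (k + 1 : ℕ) * Real.pi := by ring
    rw [harg, Real.cos_nat_mul_pi]
    push_cast
    ring
  have hsum : HasSum (fun k : ℕ => (-1) ^ k / ((k : ℝ) + 1) ^ (2 * N)) _ :=
    ((hasSum_nat_add_iff' 1).2 hcos).neg.congr_fun hterm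
  convert hsum using 1
  rw [sum_range_one, Nat.cast_zero, zero_pow (by positivity)]
  field_simp
  ring

theorem hasSum_altWeight_pow {m : ℕ} (hm : 0 < m) (j : ℕ) :
    HasSum (fun k => 2 / (2 * (j : ℝ) + 1) * altWeight ℝ m k ^ (2 * j + 1))
      (((-1) ^ m * Real.pi ^ (2 * m)) ^ (2 * j + 1) * (bernoulliFactor m (2 * j + 1) : ℝ)) := by
  have hzeta := hasSum_alternating_zeta (N := m * (2 * j + 1)) (by positivity)
  have hval : ((-1) ^ m * Real.pi ^ (2 * m)) ^ (2 * j + 1) * (bernoulliFactor m (2 * j + 1) : ℝ) =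
      2 / (2 * (j : ℝ) + 1) *
        ((-1) ^ (m * (2 * j + 1)) * Real.pi ^ (2 * (m * (2 * j + 1))) *
          ((2 - 2 ^ (2 * (m * (2 * j + 1)))) * bernoulli (2 * (m * (2 * j + 1))) /
            (2 * (2 * (m * (2 * j + 1))).factorial))) := by
    rw [bernoulliFactor, mul_pow, ← pow_mul, ← pow_mul, mul_assoc 2 m]
    push_cast
    field_simp
  rw [hval]
  refine (hzeta.mul_left _).congr_fun fun k => ?_
  rw [altWeight, div_pow, pow_right_comm, (odd_two_mul_add_one j).neg_one_pow, ← pow_mul,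
    mul_assoc]

theorem oddBell_bernoulliFactor (m r n : ℕ) :
    oddBell r (fun j => (bernoulliFactor m (2 * j + 1) : ℝ)) n = bellSum m r n := by
  rw [oddBell, bellSum]
  push_cast
  rfl

theorem hasSum_zetaStarTerm_of_hasKernelExpansion {m : ℕ} (hm : 0 < m) {s : List ℕ} {r n : ℕ}
    (hn : n + 1 ≤ 2 * r)
    (h : HasKernelExpansion s (altWeight ℝ m * starCoeff (altWeight ℝ m) n)) :
    HasSum (zetaStarTerm s)
      (((-1) ^ m * Real.pi ^ (2 * m)) ^ (n + 1) * (bellSum m r (n + 1) : ℝ)) := by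
  have hv : Summable (altWeight ℝ m) := (hasSum_alternating_zeta hm.ne').summable
  have hsum := h.hasSum (summable_mul_starCoeff hv n)
  simp only [Pi.mul_apply] at hsum
  rwa [two_mul_tsum_mul_starCoeff hv hn fun j _ => hasSum_altWeight_pow hm j, oddBell_pow_mul,
    oddBell_bernoulliFactor] at hsum

end BernoulliValues

theorem theorem4 (m d : ℕ) (hm : 0 < m) (hd : 0 < d) :
    (Summable (zetaStarTerm (blocks m d)) ∧
      zetaStar (blocks m d) = Real.pi ^ (4 * m * d) * (bellSum m d (2 * d) : ℝ)) ∧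
    (Summable (zetaStarTerm (blocks m d ++ List.replicate m 2)) ∧
      zetaStar (blocks m d ++ List.replicate m 2) =
        (-1) ^ m * Real.pi ^ (2 * m * (2 * d + 1)) * (bellSum m (d + 1) (2 * d + 1) : ℝ)) := by
  have hblocks : HasSum (zetaStarTerm (blocks m d))
      (((-1) ^ m * Real.pi ^ (2 * m)) ^ (2 * d) * (bellSum m d (2 * d) : ℝ)) := by
    obtain ⟨e, rfl⟩ := Nat.exists_eq_add_one.2 hd
    exact hasSum_zetaStarTerm_of_hasKernelExpansion hm le_rfl (hasKernelExpansion_blocks hm e)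
  have happend := hasSum_zetaStarTerm_of_hasKernelExpansion hm (r := d + 1) (by lia)
    (hasKernelExpansion_blocks_append_replicate_two hm d)
  refine ⟨⟨hblocks.summable, hblocks.tsum_eq.trans ?_⟩,
    happend.summable, happend.tsum_eq.trans ?_⟩
  · rw [mul_pow, pow_right_comm, (even_two_mul d).neg_one_pow, one_pow, one_mul, ← pow_mul]
    ring_nf
  · rw [mul_pow, ← pow_mul, ← pow_mul, pow_mul', (odd_two_mul_add_one d).neg_one_pow]
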